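/- Let $F$ be a field with $\operatorname{char}F\neq 2$, let $V$ be a four-dimensional vector space over $F$ with a non-degenerate symmetric bilinear form $h$, and fix an $F$-linear isomorphism $b\colon\bigwedge^4V\to F$. On $\bigwedge^2V$ consider the symmetric bilinear forms given by $\bigwedge^2h(v_1\wedge v_2,w_1\wedge w_2)=\det(h(v_i,w_j))$ and $\mathrm{Pf}(x,y)=b(x\wedge y)$. Let $J\colon\bigwedge^2V\to\bigwedge^2V$ be the Hodge operator, defined by $\mathrm{Pf}(J(x),y)=\bigwedge^2h(x,y)$ for all $x,y$. Then $J^2=\delta\,\mathrm{id}$ with $\delta=\det(h(v_i,v_j))/b(v_1\wedge v_2\wedge v_3\wedge v_4)^2$ for any basis $v_1,\dots,v_4$ of $V$. Let $K=F\oplus jF$ be the commutative $F$-algebra with $j^2=\delta$. Then $\bigwedge^2V$ is a $K$-module, where $j$ acts as $J$, and $g(x,y)=\bigwedge^2h(x,y)+j\,\mathrm{Pf}(x,y)$ is a symmetric $K$-bilinear form on it. The map $s\mapsto\bigwedge^2s$ defines a homomorphism $\eta\colon\mathrm{SO}(V,h)\to\mathrm{O}(\bigwedge^2V,g)$. For a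 symmetric bilinear form $B$ on a module $M$ over a commutative ring $R$, an Eichler transformation of $(M,B)$ is a map $\Sigma_{z,w,p}\colon x\mapsto x+z\,B(w,x)-(w+z\,p)\,B(z,x)$ with $z,w\in M$, $p\in R$, $B(z,z)=0=B(z,w)$ and $2p=B(w,w)$; the group $\mathrm{EO}(M,B)\le\mathrm{O}(M,B)$ is generated by all Eichler transformations. Assume that $K$ is not split, that is, $K$ has no divisors of zero. Then the following hold. 1. $\eta(\mathrm{SO}(V,h))$ contains $\mathrm{EO}(\bigwedge^2V,g)$. 2. Every Eichler transformation of $(V,h)$ belongs to $\mathrm{SO}(V,h)$, and $\eta$ maps it to an Eichler transformation of $(\bigwedge^2V,g)$. 3. If $h$ is isotropic (i.e., $h(z,z)=0$ for some $z\neq0$), then the set of absolute points of the polarity $U\leftrightarrow U^{\perp_g}$ of the projective plane $\mathrm{PG}_K(\bigwedge^2V)$ (the one-dimensional $K$-subspaces $P$ with $P\le P^{\perp_g}$) is not empty, and $\eta(\mathrm{SO}(V,h))$ acts transitively on it. -/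

import Mathlib

noncomputable section

open Module

/-! ### Orthogonal groups and Eichler transformations of symmetric bilinear forms -/

section Orthogonal

variable {R M : Type*} [CommRing R] [AddCommGroup M] [Module R M]

/-- The orthogonal group `O(M, B)` of a bilinear form: all linear automorphisms preserving `B`. -/
def orthGroup (B : LinearMap.BilinForm R M) : Subgroup (M ≃ₗ[R] M) where
  carrier := {f | ∀ x y, B (f x) (f y) = B x y}
  mul_mem' {f g} hf hg x y := by
    change B (f (g x)) (f (g y)) = B x y
    rw [hf, hg]
  one_mem' _ _ := rfl
  inv_mem' {f} hf x y := by
    change B (f.symm x) (f.symm y) = B x y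
    rw [← hf, LinearEquiv.apply_symm_apply, LinearEquiv.apply_symm_apply]

/-- The special orthogonal group `SO(M, B)`, as a subgroup of `O(M, B)`. -/
def specialOrthGroup (B : LinearMap.BilinForm R M) : Subgroup (orthGroup B) where
  carrier := {f | LinearMap.det (f.1 : M →ₗ[R] M) = 1}
  mul_mem' {f g} hf hg := by
    change LinearMap.det ((f.1 : M →ₗ[R] M) ∘ₗ (g.1 : M →ₗ[R] M)) = 1
    rw [LinearMap.det_comp, hf, hg, one_mul]
  one_mem' := LinearMap.det_id
  inv_mem' {f} hf := by
    change LinearMap.det (f.1.symm : M →ₗ[R] M) = 1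
    have h := LinearEquiv.det_symm_mul_det f.1
    rwa [show LinearMap.det (f.1 : M →ₗ[R] M) = 1 from hf, mul_one] at h

/-- `τ ∈ O(M, B)` is an Eichler (or Siegel) transformation `Σ_{z,w,p}`, that is,
`τ x = x + z B(w, x) - (w + z p) B(z, x)`, where `B(z, z) = 0 = B(z, w)` and `p + p = B(w, w)`. -/
def IsEichler (B : LinearMap.BilinForm R M) (τ : orthGroup B) : Prop :=
  ∃ (z w : M) (p : R), B z z = 0 ∧ B z w = 0 ∧ p + p = B w w ∧
    ∀ x, τ.1 x = x + B w x • z - B z x • (w + p • z)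

/-- For a symmetric form, each admissible triple `z, w, p` does define an element `Σ_{z,w,p}` of the
orthogonal group. -/
theorem exists_eichler {B : LinearMap.BilinForm R M} (hB : B.IsSymm) {z w : M} {p : R}
    (hz : B z z = 0) (hzw : B z w = 0) (hp : p + p = B w w) :
    ∃ τ : orthGroup B, ∀ x, τ.1 x = x + B w x • z - B z x • (w + p • z) := by
  have hwz : B w z = 0 := by rw [hB.eq w z, hzw]
  let f : M →ₗ[R] M :=
    LinearMap.id + (B w).smulRight z - (B z).smulRight (w + p • z)
  let f' : M →ₗ[R] M :=
    LinearMap.id + (B (-w)).smulRight z - (B z).smulRight (-w + p • z)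
  have hf : ∀ x, f x = x + B w x • z - B z x • (w + p • z) := fun x => rfl
  have hf' : ∀ x, f' x = x + B (-w) x • z - B z x • (-w + p • z) := fun x => rfl
  refine ⟨⟨LinearEquiv.ofLinearMap f f' ?_ ?_, ?_⟩, fun x => hf x⟩
  · ext x
    simp only [LinearMap.comp_apply, hf, hf', map_add, map_sub, map_smul, map_neg,
      LinearMap.neg_apply, hz, hzw, hwz, ← hp, smul_eq_mul, LinearMap.id_apply]
    module
  · ext x
    simp only [LinearMap.comp_apply, hf, hf', map_add, map_sub, map_smul, map_neg,
      LinearMap.neg_apply, hz, hzw, hwz, ← hp, smul_eq_mul, LinearMap.id_apply]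
    module
  · intro x y
    change B (f x) (f y) = B x y
    simp only [hf, map_add, map_sub, map_smul, LinearMap.add_apply, LinearMap.sub_apply,
      LinearMap.smul_apply, hz, hzw, hwz, ← hp, smul_eq_mul, hB.eq x z, hB.eq x w]
    ring

/-- The Eichler group `EO(M, B) ≤ O(M, B)`, generated by all Eichler transformations. -/
def eichlerGroup (B : LinearMap.BilinForm R M) : Subgroup (orthGroup B) :=
  Subgroup.closure {τ | IsEichler B τ}

/-- The absolute points of the polarity `U ↔ U^⊥` defined by `B`: the points `X R` (with `X ≠ 0`)
of the projective space that are incident with their polars. -/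
def absolutePoints (B : LinearMap.BilinForm R M) : Set (Submodule R M) :=
  {P | (∃ X : M, X ≠ 0 ∧ P = Submodule.span R {X}) ∧ P ≤ B.orthogonal P}

/-- The orthogonal group acts on the absolute points by `P ↦ τ(P)`. -/
instance absolutePoints.mulAction (B : LinearMap.BilinForm R M) :
    MulAction (orthGroup B) (absolutePoints B) where
  smul τ P := ⟨P.1.map (τ.1 : M →ₗ[R] M), by
    obtain ⟨P, ⟨X, hX, rfl⟩, hP⟩ := P
    refine ⟨⟨τ.1 X, by simpa using hX, by simp [Submodule.map_span]⟩, ?_⟩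
    rintro _ ⟨x, hx, rfl⟩ _ ⟨y, hy, rfl⟩
    exact (τ.2 y x).trans (hP hx y hy)⟩
  one_smul P := Subtype.ext (Submodule.map_id P.1)
  mul_smul σ τ P := Subtype.ext (Submodule.map_comp (τ.1 : M →ₗ[R] M) (σ.1 : M →ₗ[R] M) P.1)

theorem absolutePoints.coe_smul (B : LinearMap.BilinForm R M) (τ : orthGroup B)
    (P : absolutePoints B) :
    ((τ • P : absolutePoints B) : Submodule R M) = P.1.map (τ.1 : M →ₗ[R] M) := rfl

end Orthogonal

/-- An algebra is split if it contains divisors of zero. -/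
def IsSplitAlg (K : Type*) [CommRing K] : Prop :=
  ∃ x y : K, x ≠ 0 ∧ y ≠ 0 ∧ x * y = 0

/-! ### The Hodge operator on the exterior square of a four-dimensional space -/

section Wedge

variable {F V : Type*} [Field F] [AddCommGroup V] [Module F V]

/-- The bivector `u ∧ v`. -/
def wedge (F : Type*) {V : Type*} [Field F] [AddCommGroup V] [Module F V] (u v : V) : ⋀[F]^2 V :=
  exteriorPower.ιMulti F 2 ![u, v]

theorem ιMulti_two (a : Fin 2 → V) : exteriorPower.ιMulti F 2 a = wedge F (a 0) (a 1) := by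
  unfold wedge
  congr 1
  ext i
  fin_cases i <;> rfl

theorem wedge_ext {N : Type*} [AddCommGroup N] [Module F N] {f g : ⋀[F]^2 V →ₗ[F] N}
    (H : ∀ u v, f (wedge F u v) = g (wedge F u v)) : f = g := by
  apply exteriorPower.linearMap_ext
  ext a
  simpa [ιMulti_two] using H (a 0) (a 1)

/-- The form induced by `h` on the exterior square:
`⋀²h (v₁ ∧ v₂, w₁ ∧ w₂) = det (h (vᵢ, wⱼ))`. -/
def extForm (h : LinearMap.BilinForm F V) : LinearMap.BilinForm F (⋀[F]^2 V) :=
  exteriorPower.pairingDual F V 2 ∘ₗ exteriorPower.map 2 h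

theorem extForm_wedge (h : LinearMap.BilinForm F V) (a b c d : V) :
    extForm h (wedge F a b) (wedge F c d) = h a c * h b d - h a d * h b c := by
  simp only [extForm, wedge, LinearMap.comp_apply, exteriorPower.map_apply_ιMulti,
    exteriorPower.pairingDual_ιMulti_ιMulti, Matrix.det_fin_two]
  simp
  ring

theorem map_wedge (f : V →ₗ[F] V) (a b : V) :
    exteriorPower.map 2 f (wedge F a b) = wedge F (f a) (f b) := by
  rw [wedge, exteriorPower.map_apply_ιMulti, ιMulti_two]
  rfl

end Wedge

/-- A four-dimensional vector space `V` over `F` with a non-degenerate symmetric bilinear form `h`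
and an isomorphism `b : ⋀⁴V → F`. -/
structure HodgeSpace (F V : Type*) [Field F] [AddCommGroup V] [Module F V] where
  h : LinearMap.BilinForm F V
  symm : h.IsSymm
  nondeg : h.Nondegenerate
  finrank_eq : finrank F V = 4
  b : ⋀[F]^4 V ≃ₗ[F] F

namespace HodgeSpace

variable {F V : Type*} [Field F] [AddCommGroup V] [Module F V] (S : HodgeSpace F V)

/-- The Pfaffian form `Pf(x, y) = b(x ∧ y)` on `⋀²V`. -/
def pf : LinearMap.BilinForm F (⋀[F]^2 V) :=
  LinearMap.mk₂ F
    (fun x y => S.b ⟨x.1 * y.1, by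
      have := Submodule.mul_mem_mul x.2 y.2
      rwa [← pow_add] at this⟩)
    (fun x x' y => by rw [← map_add]; congr 1; ext; simp [add_mul])
    (fun c x y => by rw [← map_smul]; congr 1; ext; simp)
    (fun x y y' => by rw [← map_add]; congr 1; ext; simp [mul_add])
    (fun c x y => by rw [← map_smul]; congr 1; ext; simp)

theorem pf_wedge (u v w x : V) :
    S.pf (wedge F u v) (wedge F w x) = S.b (exteriorPower.ιMulti F 4 ![u, v, w, x]) := by
  simp only [pf, LinearMap.mk₂_apply]
  congr 1
  ext
  simp [wedge, ExteriorAlgebra.ιMulti_apply, mul_assoc]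

/-- The value of `b` on the product of four basis vectors. -/
def vol (v : Basis (Fin 4) F V) : F := S.b (exteriorPower.ιMulti F 4 v)

theorem b_ιMulti (v : Basis (Fin 4) F V) (a : Fin 4 → V) :
    S.b (exteriorPower.ιMulti F 4 a) = S.vol v * v.det a := by
  have := (S.b.toLinearMap.compAlternatingMap (exteriorPower.ιMulti F 4)).eq_smul_basis_det v
  simpa [vol] using congrArg (fun f => f a) this

theorem vol_ne_zero (v : Basis (Fin 4) F V) : S.vol v ≠ 0 := by
  intro h0
  have h1 : S.b.toLinearMap = 0 := by
    apply exteriorPower.linearMap_ext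
    ext a
    simp [S.b_ιMulti v, h0]
  have h2 := congrArg (fun f => f (S.b.symm 1)) h1
  simp at h2

/-- The preimage of a linear form under `Pf`, written out in coordinates. -/
def pfInv (v : Basis (Fin 4) F V) (φ : Dual F (⋀[F]^2 V)) : ⋀[F]^2 V :=
  (S.vol v)⁻¹ • (φ (wedge F (v 0) (v 1)) • wedge F (v 2) (v 3)
    - φ (wedge F (v 0) (v 2)) • wedge F (v 1) (v 3)
    + φ (wedge F (v 0) (v 3)) • wedge F (v 1) (v 2)
    + φ (wedge F (v 1) (v 2)) • wedge F (v 0) (v 3)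
    - φ (wedge F (v 1) (v 3)) • wedge F (v 0) (v 2)
    + φ (wedge F (v 2) (v 3)) • wedge F (v 0) (v 1))

theorem wedge_swap (u v : V) : wedge F u v = - wedge F v u := by
  have := (exteriorPower.ιMulti F 2).map_swap ![v, u] (i := 0) (j := 1) (by decide)
  rw [ιMulti_two, ιMulti_two] at this
  simpa using this

theorem wedge_self (u : V) : wedge F u u = 0 :=
  (exteriorPower.ιMulti F 2).map_eq_zero_of_eq ![u, u] (i := 0) (j := 1) rfl (by decide)

theorem pf_pfInv (v : Basis (Fin 4) F V) (φ : Dual F (⋀[F]^2 V)) :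
    S.pf (S.pfInv v φ) = φ := by
  have h0 := S.vol_ne_zero v
  apply exteriorPower.linearMap_ext
  refine Basis.ext_alternating v fun i hi => ?_
  have zero : ∀ i j k l : Fin 4, (i = k ∨ i = l ∨ j = k ∨ j = l) →
      S.pf (wedge F (v i) (v j)) (wedge F (v k) (v l)) = 0 := by
    intro i j k l H
    rw [pf_wedge]
    obtain rfl | rfl | rfl | rfl := H
    · rw [AlternatingMap.map_eq_zero_of_eq _ _ (i := 0) (j := 2) rfl (by decide), map_zero]
    · rw [AlternatingMap.map_eq_zero_of_eq _ _ (i := 0) (j := 3) rfl (by decide), map_zero]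
    · rw [AlternatingMap.map_eq_zero_of_eq _ _ (i := 1) (j := 2) rfl (by decide), map_zero]
    · rw [AlternatingMap.map_eq_zero_of_eq _ _ (i := 1) (j := 3) rfl (by decide), map_zero]
  have key : ∀ (σ : Equiv.Perm (Fin 4)) (ε : ℤ) (i j k l : Fin 4),
      (Equiv.Perm.sign σ = ε ∧ σ 0 = i ∧ σ 1 = j ∧ σ 2 = k ∧ σ 3 = l) →
      S.pf (wedge F (v i) (v j)) (wedge F (v k) (v l)) = ε * S.vol v := by
    rintro σ ε _ _ _ _ ⟨hε, rfl, rfl, rfl, rfl⟩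
    have h1 := (exteriorPower.ιMulti F 4).map_perm v σ
    have h2 : (![v (σ 0), v (σ 1), v (σ 2), v (σ 3)] : Fin 4 → V) = v ∘ σ := by
      ext i
      fin_cases i <;> rfl
    rw [pf_wedge, h2, h1, Units.smul_def, hε, map_zsmul, zsmul_eq_mul, vol]
  have k1 := key (Equiv.swap 0 2 * Equiv.swap 1 3) 1 2 3 0 1 (by decide)
  have k2 := key (Equiv.swap 0 1 * Equiv.swap 1 3 * Equiv.swap 2 3) (-1) 1 3 0 2 (by decide)
  have k3 := key (Equiv.swap 0 1 * Equiv.swap 1 2) 1 1 2 0 3 (by decide)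
  have k4 := key (Equiv.swap 1 3 * Equiv.swap 2 3) 1 0 3 1 2 (by decide)
  have k5 := key (Equiv.swap 1 2) (-1) 0 2 1 3 (by decide)
  have k6 := key 1 1 0 1 2 3 (by decide)
  have main : ∀ k l : Fin 4, k < l →
      S.pf (S.pfInv v φ) (wedge F (v k) (v l)) = φ (wedge F (v k) (v l)) := by
    intro k l hkl
    simp only [pfInv, map_smul, map_add, map_sub, LinearMap.smul_apply, LinearMap.add_apply,
      LinearMap.sub_apply, smul_eq_mul]
    fin_cases k <;> fin_cases l <;> simp at hkl <;>
      simp only [Fin.zero_eta, Fin.mk_one, Fin.reduceFinMk, k1, k2, k3, k4, k5, k6] <;>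
      repeat rw [zero _ _ _ _ (by decide)]
    all_goals
      push_cast
      field_simp
      ring
  have h01 := hi.ne (show (0 : Fin 2) ≠ 1 by decide)
  simp only [LinearMap.compAlternatingMap_apply, ιMulti_two]
  rcases lt_or_gt_of_ne h01 with h | h
  · exact main _ _ h
  · rw [wedge_swap, map_neg, map_neg, main _ _ h]

theorem finite (S : HodgeSpace F V) : Module.Finite F V :=
  Module.finite_of_finrank_pos (by rw [S.finrank_eq]; norm_num)

/-- A basis of `V`, used to write down `δ`. -/
def basis : Basis (Fin 4) F V :=
  haveI := S.finite
  finBasisOfFinrankEq F V S.finrank_eq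

theorem pf_bijective : Function.Bijective S.pf := by
  have := S.finite
  have hs : Function.Surjective S.pf := fun φ => ⟨S.pfInv S.basis φ, S.pf_pfInv S.basis φ⟩
  refine ⟨?_, hs⟩
  exact (LinearMap.injective_iff_surjective_of_finrank_eq_finrank
    (Subspace.dual_finrank_eq (K := F) (V := ⋀[F]^2 V)).symm).2 hs

/-- The isomorphism `Pf : ⋀²V → (⋀²V)^∨`. -/
def pfEquiv : ⋀[F]^2 V ≃ₗ[F] Dual F (⋀[F]^2 V) :=
  LinearEquiv.ofBijective S.pf S.pf_bijective

/-- The Hodge operator `J = Pf⁻¹ ∘ ⋀²h`. -/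
def hodge : ⋀[F]^2 V →ₗ[F] ⋀[F]^2 V :=
  S.pfEquiv.symm.toLinearMap ∘ₗ extForm S.h

/-- `δ = (-1)^ℓ det(H) / b(v₁ ∧ v₂ ∧ v₃ ∧ v₄)²` with `ℓ = 2`, where `H` is the Gram matrix of `h`.
It does not depend on the basis, see `delta_eq`. -/
def delta : F :=
  (-1) ^ 2 * (Matrix.of fun i j => S.h (S.basis i) (S.basis j)).det / S.vol S.basis ^ 2

theorem pf_hodge (x y : ⋀[F]^2 V) : S.pf (S.hodge x) y = extForm S.h x y :=
  congrArg (fun f => f y) (S.pfEquiv.apply_symm_apply (extForm S.h x))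

theorem hodge_eq_pfInv (v : Basis (Fin 4) F V) (x : ⋀[F]^2 V) :
    S.hodge x = S.pfInv v (extForm S.h x) := by
  apply S.pf_bijective.1
  rw [pf_pfInv]
  refine LinearMap.ext fun y => ?_
  exact S.pf_hodge x y

theorem extForm_hodge (v : Basis (Fin 4) F V) (x y : ⋀[F]^2 V) :
    extForm S.h (S.hodge x) y =
      (Matrix.of fun i j => S.h (v i) (v j)).det / S.vol v ^ 2 * S.pf x y := by
  have h0 := S.vol_ne_zero v
  suffices H : extForm S.h ∘ₗ S.hodge =
      ((Matrix.of fun i j => S.h (v i) (v j)).det / S.vol v ^ 2) • S.pf from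
    congrArg (fun f => f x y) H
  refine wedge_ext fun a b => wedge_ext fun c d => ?_
  have hcd : ∀ i j, extForm S.h (wedge F (v i) (v j)) (wedge F c d) =
      S.h c (v i) * S.h d (v j) - S.h d (v i) * S.h c (v j) := by
    intro i j
    rw [extForm_wedge, S.symm.eq (v i), S.symm.eq (v i), S.symm.eq (v j), S.symm.eq (v j)]
  have hdet : (Matrix.of fun i j => S.h (![a, b, c, d] i) (v j)).det =
      v.det ![a, b, c, d] * (Matrix.of fun i j => S.h (v i) (v j)).det := by
    rw [Basis.det_apply, ← Matrix.det_transpose (v.toMatrix _), ← Matrix.det_mul]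
    congr 1
    ext i j
    rw [Matrix.mul_apply, Matrix.of_apply]
    conv_lhs => rw [← v.sum_repr (![a, b, c, d] i)]
    rw [map_sum, LinearMap.sum_apply]
    simp only [Matrix.transpose_apply, Matrix.of_apply, Basis.toMatrix_apply, map_smul,
      LinearMap.smul_apply, smul_eq_mul]
  have hpf : S.pf (wedge F a b) (wedge F c d) = S.vol v * v.det ![a, b, c, d] := by
    rw [pf_wedge, S.b_ιMulti v]
  simp only [LinearMap.comp_apply, LinearMap.smul_apply, smul_eq_mul]
  rw [hpf, S.hodge_eq_pfInv v, pfInv]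
  simp only [map_smul, map_add, map_sub, LinearMap.smul_apply, LinearMap.add_apply,
    LinearMap.sub_apply, smul_eq_mul, hcd]
  have : ∀ A B C D : F, C ≠ 0 → A = D * B → C⁻¹ * A = B / C ^ 2 * (C * D) := by
    intro A B C D hC h
    rw [h]
    field_simp
  refine this _ _ _ _ h0 ?_
  rw [← hdet]
  simp only [extForm_wedge, Matrix.det_succ_row_zero, Fin.sum_univ_succ]
  simp [Fin.succAbove]
  ring

theorem extForm_symm (x y : ⋀[F]^2 V) : extForm S.h x y = extForm S.h y x := by
  suffices H : extForm S.h = (extForm S.h).flip from congrArg (fun f => f x y) H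
  refine wedge_ext fun a b => wedge_ext fun c d => ?_
  change _ = extForm S.h (wedge F c d) (wedge F a b)
  rw [extForm_wedge, extForm_wedge, S.symm.eq c a, S.symm.eq d b,
    S.symm.eq c b, S.symm.eq d a]
  ring

theorem extForm_hodge_left (x y : ⋀[F]^2 V) :
    extForm S.h (S.hodge x) y = S.delta * S.pf x y := by
  rw [S.extForm_hodge S.basis, delta]
  ring

theorem hodge_hodge (x : ⋀[F]^2 V) : S.hodge (S.hodge x) = S.delta • x := by
  apply S.pf_bijective.1
  refine LinearMap.ext fun y => ?_
  rw [pf_hodge, extForm_hodge_left, map_smul, LinearMap.smul_apply, smul_eq_mul]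

theorem pf_symm (x y : ⋀[F]^2 V) : S.pf x y = S.pf y x := by
  suffices H : S.pf = S.pf.flip from congrArg (fun f => f x y) H
  refine wedge_ext fun a b => wedge_ext fun c d => ?_
  change _ = S.pf (wedge F c d) (wedge F a b)
  rw [pf_wedge, pf_wedge]
  have h := (exteriorPower.ιMulti F 4).map_perm ![a, b, c, d] (Equiv.swap 0 2 * Equiv.swap 1 3)
  have h2 : ![a, b, c, d] ∘ (Equiv.swap (0 : Fin 4) 2 * Equiv.swap 1 3 : Equiv.Perm (Fin 4)) =
      ![c, d, a, b] := by
    ext i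
    fin_cases i <;> rfl
  rw [h2, show Equiv.Perm.sign (Equiv.swap (0 : Fin 4) 2 * Equiv.swap 1 3) = 1 by decide,
    one_smul] at h
  rw [h]

theorem delta_eq (v : Basis (Fin 4) F V) :
    S.delta = (-1) ^ 2 * (Matrix.of fun i j => S.h (v i) (v j)).det / S.vol v ^ 2 := by
  have h := S.extForm_hodge v (wedge F (v 0) (v 1)) (wedge F (v 2) (v 3))
  have h1 : S.pf (wedge F (v 0) (v 1)) (wedge F (v 2) (v 3)) = S.vol v := by
    rw [pf_wedge, vol]
    congr 2
  rw [extForm_hodge_left, h1] at h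
  rw [mul_right_cancel₀ (S.vol_ne_zero v) h]
  ring

/-! ### The algebra `K`, the `K`-module `⋀²V`, the form `g`, and the homomorphism `η` -/

/-- The algebra `K = F ⊕ jF` with `j² = δ`, that is, the algebra of all matrices
`!![x₀, δ x₁; x₁, x₀]` over `F`. The element `x₀ + j x₁` has components `re = x₀`, `im = x₁`. -/
abbrev K : Type _ := QuadraticAlgebra F S.delta 0

/-- The exterior square `⋀²V`, to be considered as a module over `K`. -/
def W (_S : HodgeSpace F V) : Type _ := ⋀[F]^2 V

instance : AddCommGroup S.W := inferInstanceAs (AddCommGroup (⋀[F]^2 V))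

instance : Module F S.W := inferInstanceAs (Module F (⋀[F]^2 V))

/-- The identity map `⋀²V → W`. -/
def toW : ⋀[F]^2 V ≃ₗ[F] S.W := LinearEquiv.refl F (⋀[F]^2 V)

/-- The `K`-module structure on `⋀²V`, with `j` acting as the Hodge operator `J`. -/
instance : Module S.K S.W where
  smul a x := S.toW (a.re • S.toW.symm x + a.im • S.hodge (S.toW.symm x))
  one_smul x := by
    change (1 : F) • x + (0 : F) • S.toW (S.hodge (S.toW.symm x)) = x
    simp
  mul_smul a c x := by
    change S.toW ((a * c).re • S.toW.symm x + (a * c).im • S.hodge (S.toW.symm x)) =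
      S.toW (a.re • (c.re • S.toW.symm x + c.im • S.hodge (S.toW.symm x)) +
        a.im • S.hodge (c.re • S.toW.symm x + c.im • S.hodge (S.toW.symm x)))
    congr 1
    rw [map_add, map_smul, map_smul, hodge_hodge, QuadraticAlgebra.re_mul, QuadraticAlgebra.im_mul]
    module
  smul_zero a := by
    change S.toW (a.re • (0 : ⋀[F]^2 V) + a.im • S.hodge 0) = 0
    simp
  smul_add a x y := by
    change S.toW (a.re • S.toW.symm (x + y) + a.im • S.hodge (S.toW.symm (x + y))) =
      S.toW (a.re • S.toW.symm x + a.im • S.hodge (S.toW.symm x)) +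
        S.toW (a.re • S.toW.symm y + a.im • S.hodge (S.toW.symm y))
    rw [← map_add S.toW, map_add S.toW.symm, map_add S.hodge]
    congr 1
    module
  add_smul a c x := by
    change S.toW ((a + c).re • S.toW.symm x + (a + c).im • S.hodge (S.toW.symm x)) =
      S.toW (a.re • S.toW.symm x + a.im • S.hodge (S.toW.symm x)) +
        S.toW (c.re • S.toW.symm x + c.im • S.hodge (S.toW.symm x))
    rw [← map_add, QuadraticAlgebra.re_add, QuadraticAlgebra.im_add]
    congr 1
    module
  zero_smul x := by
    change (0 : F) • x + (0 : F) • S.toW (S.hodge (S.toW.symm x)) = 0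
    simp

theorem smul_def (a : S.K) (x : S.W) :
    a • x = S.toW (a.re • S.toW.symm x + a.im • S.hodge (S.toW.symm x)) := rfl

/-- The form `g(u, v) = ⋀²h(u, v) + j (-1)^ℓ Pf(u, v)` with `ℓ = 2`, a symmetric `K`-bilinear form
on `⋀²V`. -/
def g : LinearMap.BilinForm S.K S.W :=
  LinearMap.mk₂ S.K
    (fun u v => ⟨extForm S.h (S.toW.symm u) (S.toW.symm v),
      (-1) ^ 2 * S.pf (S.toW.symm u) (S.toW.symm v)⟩)
    (fun u u' v => by ext <;> simp)
    (fun a u v => by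
      ext
      · simp [smul_def, extForm_hodge_left]
        ring
      · simp [smul_def, pf_hodge])
    (fun u v v' => by ext <;> simp)
    (fun a u v => by
      ext
      · simp [smul_def, S.extForm_symm _ (S.hodge _), extForm_hodge_left,
          S.pf_symm (S.toW.symm v)]
        ring
      · simp [smul_def, S.pf_symm _ (S.hodge _), pf_hodge, S.extForm_symm (S.toW.symm v)])

theorem g_apply (u v : S.W) :
    S.g u v = ⟨extForm S.h (S.toW.symm u) (S.toW.symm v),
      (-1) ^ 2 * S.pf (S.toW.symm u) (S.toW.symm v)⟩ := rfl

theorem g_symm : S.g.IsSymm := ⟨fun u v => by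
  rw [g_apply, g_apply, S.extForm_symm, S.pf_symm]⟩

theorem extForm_map (f : orthGroup S.h) (x y : ⋀[F]^2 V) :
    extForm S.h (exteriorPower.map 2 (f.1 : V →ₗ[F] V) x)
      (exteriorPower.map 2 (f.1 : V →ₗ[F] V) y) = extForm S.h x y := by
  suffices H : (extForm S.h).compl₁₂ (exteriorPower.map 2 (f.1 : V →ₗ[F] V))
      (exteriorPower.map 2 (f.1 : V →ₗ[F] V)) = extForm S.h from congrArg (fun f => f x y) H
  refine wedge_ext fun a b => wedge_ext fun c d => ?_
  have hf : ∀ x y, S.h (f.1 x) (f.1 y) = S.h x y := f.2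
  simp only [LinearMap.compl₁₂_apply, map_wedge, extForm_wedge, LinearEquiv.coe_coe, hf]

theorem pf_map (f : V →ₗ[F] V) (x y : ⋀[F]^2 V) :
    S.pf (exteriorPower.map 2 f x) (exteriorPower.map 2 f y) = LinearMap.det f * S.pf x y := by
  suffices H : S.pf.compl₁₂ (exteriorPower.map 2 f) (exteriorPower.map 2 f) =
      LinearMap.det f • S.pf from congrArg (fun f => f x y) H
  refine wedge_ext fun a b => wedge_ext fun c d => ?_
  have h : (![f a, f b, f c, f d] : Fin 4 → V) = f ∘ ![a, b, c, d] := by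
    ext i
    fin_cases i <;> rfl
  simp only [LinearMap.compl₁₂_apply, map_wedge, LinearMap.smul_apply, smul_eq_mul, pf_wedge,
    S.b_ιMulti S.basis, h, Basis.det_comp]
  ring

/-- The action of `f ∈ GL(V)` on `⋀²V`. -/
def extEquiv (f : V ≃ₗ[F] V) : ⋀[F]^2 V ≃ₗ[F] ⋀[F]^2 V :=
  LinearEquiv.ofLinearMap (exteriorPower.map 2 (f : V →ₗ[F] V))
    (exteriorPower.map 2 (f.symm : V →ₗ[F] V))
    (by rw [← exteriorPower.map_comp]; simp) (by rw [← exteriorPower.map_comp]; simp)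

theorem hodge_map (s : specialOrthGroup S.h) (x : ⋀[F]^2 V) :
    S.hodge (exteriorPower.map 2 (s.1.1 : V →ₗ[F] V) x) =
      exteriorPower.map 2 (s.1.1 : V →ₗ[F] V) (S.hodge x) := by
  have hs : LinearMap.det (s.1.1 : V →ₗ[F] V) = 1 := s.2
  apply S.pf_bijective.1
  refine LinearMap.ext fun y => ?_
  obtain ⟨y, rfl⟩ := (extEquiv s.1.1).surjective y
  change S.pf _ (exteriorPower.map 2 (s.1.1 : V →ₗ[F] V) y) =
    S.pf _ (exteriorPower.map 2 (s.1.1 : V →ₗ[F] V) y)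
  rw [pf_hodge, extForm_map, pf_map, hs, one_mul, pf_hodge]

/-- The homomorphism `η : SO(V, h) → O(⋀²V, g)`, `s ↦ ⋀²s`. -/
def eta : specialOrthGroup S.h →* orthGroup S.g where
  toFun s :=
    ⟨{ toFun := fun x => S.toW (extEquiv s.1.1 (S.toW.symm x))
       invFun := fun x => S.toW ((extEquiv s.1.1).symm (S.toW.symm x))
       left_inv := fun x => by simp
       right_inv := fun x => by simp
       map_add' := fun x y => by simp
       map_smul' := fun a x => by
        have h : ∀ y, S.hodge (extEquiv s.1.1 y) = extEquiv s.1.1 (S.hodge y) := S.hodge_map s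
        simp [smul_def, h] }, fun x y => by
      change S.g (S.toW (exteriorPower.map 2 (s.1.1 : V →ₗ[F] V) (S.toW.symm x)))
        (S.toW (exteriorPower.map 2 (s.1.1 : V →ₗ[F] V) (S.toW.symm y))) = S.g x y
      have hs : LinearMap.det (s.1.1 : V →ₗ[F] V) = 1 := s.2
      simp only [g_apply, LinearEquiv.symm_apply_apply, extForm_map, pf_map, hs, one_mul]⟩
  map_one' := by
    apply Subtype.ext
    ext x
    exact congrArg (fun f => f x) (exteriorPower.map_id (R := F) (M := V) (n := 2))
  map_mul' s t := by
    apply Subtype.ext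
    ext x
    exact congrArg (fun f => f x) (exteriorPower.map_comp (n := 2) (t.1.1 : V →ₗ[F] V)
      (s.1.1 : V →ₗ[F] V))

theorem eta_wedge (s : specialOrthGroup S.h) (u v : V) :
    (S.eta s).1 (S.toW (wedge F u v)) = S.toW (wedge F (s.1.1 u) (s.1.1 v)) :=
  map_wedge (s.1.1 : V →ₗ[F] V) u v

end HodgeSpace

end

open Module

/-! ### Hyperbolic frames and the action of the Eichler group on absolute points -/

section HyperbolicFrame

variable {R M : Type*} [CommRing R] [AddCommGroup M] [Module R M]

/-! Everything rests on a dictionary between isotropic vectors of `g` and of `h`. Since `K` has no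
zero divisors, `δ` is not a square and `K` is a field; moreover `V` has no totally isotropic plane,
because such a plane would make `δ` a square (`not_isotropic_of_orthogonal`). If `g(A, A) = 0`, then
`Pf(A, A) = 0` makes `A` decomposable (`exists_eq_wedge`), and `⋀²h(A, A) = 0` says that the plane
of `A` is degenerate. So a non-zero such `A` is `z ∧ w` with `z` isotropic, `w ⊥ z` and `w`
anisotropic, and `z, w` extend to a basis `z, w, y, u` adapted to `h`
(`exists_isWittFrame_of_g_self`). The bivectors `Z = z ∧ w`, `Y = z ∧ y` and a multiple `X` of `w ∧
y` form a `K`-basis with a hyperbolic Gram matrix (`isHyperbolicFrame`). Evaluation on it shows that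
`η` sends `Σ_{z,w,p}` to `Σ_{Z,Y,-1/2}` (`eta_eichler`), which is assertion 2. Conversely, every
Eichler transformation of `g` with centre `Z` is some `Σ_{kZ,Y,-1/2}` (`eichler_eq`), and `kZ = z ∧
w'` with the same `z` and `y` (`smul_wedge`), so it has a preimage; this is assertion 1. For
assertion 3, the absolute points form a conic on which explicit Eichler transformations act
transitively (`exists_smul_eq`). -/

/-- Vectors `Z, Y, X` spanning `M` such that `Z, X` is a hyperbolic pair and `Y` is orthogonal to
both, with `B(Y, Y) = -1`. -/
structure IsHyperbolicFrame (B : LinearMap.BilinForm R M) (Z Y X : M) : Prop where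
  ZZ : B Z Z = 0
  ZY : B Z Y = 0
  ZX : B Z X = 1
  YY : B Y Y = -1
  XY : B X Y = 0
  XX : B X X = 0
  expand : ∀ A, A = B X A • Z - B Y A • Y + B Z A • X

namespace IsHyperbolicFrame

variable {B : LinearMap.BilinForm R M} {Z Y X : M}

/-- Linear maps that agree on a hyperbolic frame are equal. -/
theorem hom_ext (H : IsHyperbolicFrame B Z Y X) {f f' : M →ₗ[R] M} (hZ : f Z = f' Z)
    (hY : f Y = f' Y) (hX : f X = f' X) : f = f' := by
  ext A
  rw [H.expand A]
  simp only [map_add, map_sub, map_smul, hZ, hY, hX]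

/-- An Eichler transformation with centre `Z` is `Σ_{kZ,Y,-1/2}` for some scalar `k`. -/
theorem eichler_eq (H : IsHyperbolicFrame B Z Y X) (hB : B.IsSymm) {r : R} (hr : r + r = 1)
    {W : M} {p : R} (hW : B Z W = 0) (hp : p + p = B W W) :
    ∃ k : R, ∀ x, x + B W x • Z - B Z x • (W + p • Z) =
      x + B Y x • (k • Z) - B (k • Z) x • (Y + (-r) • (k • Z)) := by
  have hYZ : B Y Z = 0 := by rw [hB.eq, H.ZY]
  have e : W = B X W • Z - B Y W • Y := by
    conv_lhs => rw [H.expand W, hW, zero_smul, add_zero]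
  generalize B X W = a at e
  generalize B Y W = k at e
  subst e
  have hWW : p + p = - k ^ 2 := by
    rw [hp]
    simp only [map_sub, map_smul, LinearMap.sub_apply, LinearMap.smul_apply, H.ZZ, H.ZY, hYZ,
      H.YY, smul_eq_mul]
    ring
  have hpr : p = - k ^ 2 * r := by linear_combination r * hWW - p * hr
  -- `B(W, x) Z - B(Z, x) W` is alternating in `Z, W`: the `Z`-part of `W` drops out, and the scalar
  -- `-k` can be moved from `Y` to `Z`.
  refine ⟨-k, fun x => ?_⟩
  simp only [map_sub, map_smul, LinearMap.sub_apply, LinearMap.smul_apply, smul_eq_mul, hpr]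
  module

/-- The Eichler group moves every absolute point to the first point of a hyperbolic frame. -/
theorem exists_smul_eq (H : IsHyperbolicFrame B Z Y X) (hB : B.IsSymm) {r : R} (hr : r + r = 1)
    (hinv : ∀ c : R, c ≠ 0 → ∃ d, c * d = 1) (P : absolutePoints B) :
    ∃ τ ∈ eichlerGroup B, (τ • P).1 = Submodule.span R {Z} := by
  suffices h : ∃ τ ∈ eichlerGroup B, ∃ c d : R, ∃ A, P.1 = Submodule.span R {A} ∧ c * d = 1 ∧
      τ.1 A = c • Z by
    obtain ⟨τ, hτ, c, d, A, hA, hcd, h⟩ := h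
    refine ⟨τ, hτ, ?_⟩
    rw [absolutePoints.coe_smul, hA, Submodule.map_span, Set.image_singleton,
      LinearEquiv.coe_coe, h]
    exact Submodule.span_singleton_smul_eq (IsUnit.of_mul_eq_one _ hcd) Z
  obtain ⟨P, ⟨A, hA0, rfl⟩, hP⟩ := P
  have hYZ : B Y Z = 0 := by rw [hB.eq, H.ZY]
  have hXZ : B X Z = 1 := by rw [hB.eq, H.ZX]
  have hYX : B Y X = 0 := by rw [hB.eq, H.XY]
  have hAA : B A A = 0 := hP (Submodule.mem_span_singleton_self A) A
    (Submodule.mem_span_singleton_self A)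
  obtain ⟨a, b, c, e⟩ : ∃ a b c : R, A = a • Z + b • Y + c • X :=
    ⟨B X A, -B Y A, B Z A, by rw [neg_smul, ← sub_eq_add_neg]; exact H.expand A⟩
  have hb : b ^ 2 = 2 * a * c := by
    rw [e] at hAA
    simp only [map_add, map_smul, LinearMap.add_apply, LinearMap.smul_apply, H.ZZ, H.ZY, hYZ,
      H.ZX, hXZ, H.YY, H.XY, hYX, H.XX, smul_eq_mul] at hAA
    linear_combination -hAA
  by_cases hc : c = 0
  · have hb0 : b = 0 := by
      by_contra hb0
      obtain ⟨d, hd⟩ := hinv b hb0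
      apply hb0
      linear_combination -b * hd + d * hb + 2 * a * d * hc
    have hAZ : A = a • Z := by rw [e, hb0, hc, zero_smul, zero_smul, add_zero, add_zero]
    obtain ⟨d, hd⟩ := hinv a fun ha => hA0 (by rw [hAZ, ha, zero_smul])
    exact ⟨1, one_mem _, a, d, A, rfl, hd, hAZ⟩
  obtain ⟨d, hd⟩ := hinv c hc
  -- `τ` sends `A` to `c X`: the choice of `w` kills the `Y`-coordinate, and then the conic equation
  -- `hb` kills the `Z`-coordinate.
  obtain ⟨τ, hτ⟩ := exists_eichler hB (z := Z) (w := (b * d) • Y) (p := -r * (b * d) ^ 2) H.ZZ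
    (by simp [H.ZY]) (by simp [H.YY]; linear_combination -(b * d) ^ 2 * hr)
  -- `σ X = X - Y + r Z` and, for the `ρ` chosen next, `ρ Z = 2 X - 2 Y + Z`. As `2 r = 1`, these
  -- span the same point, so `ρ⁻¹ σ` maps `X` to `r Z`.
  obtain ⟨σ, hσ⟩ := exists_eichler hB (z := Z) (w := Y) (p := -r) H.ZZ H.ZY
    (by rw [H.YY]; linear_combination -hr)
  obtain ⟨ρ, hρ⟩ := exists_eichler hB (z := X) (w := (2 : R) • Y) (p := -2) H.XX
    (by simp [H.XY]) (by simp [H.YY]; norm_num)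
  refine ⟨ρ⁻¹ * (σ * τ), ?_, c * r, d * 2, A, rfl, by linear_combination 2 * r * hd + hr, ?_⟩
  · refine mul_mem (inv_mem (Subgroup.subset_closure ?_))
      (mul_mem (Subgroup.subset_closure ?_) (Subgroup.subset_closure ?_))
    · exact ⟨X, (2 : R) • Y, -2, H.XX, by simp [H.XY], by simp [H.YY]; norm_num, hρ⟩
    · exact ⟨Z, Y, -r, H.ZZ, H.ZY, by rw [H.YY]; linear_combination -hr, hσ⟩
    · exact ⟨Z, (b * d) • Y, -r * (b * d) ^ 2, H.ZZ, by simp [H.ZY],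
        by simp [H.YY]; linear_combination -(b * d) ^ 2 * hr, hτ⟩
  · change ρ.1.symm (σ.1 (τ.1 A)) = (c * r) • Z
    have e1 : τ.1 A = c • X := by
      rw [hτ, e]
      simp only [map_add, map_smul, LinearMap.smul_apply, H.ZZ, H.ZY, hYZ,
        H.ZX, H.YY, hYX, smul_eq_mul]
      match_scalars
      · linear_combination (-d + r * d ^ 2 * c) * hb + (-2 * a + 2 * r * a * (c * d + 1)) * hd
          + a * hr
      · linear_combination -b * hd
      · ring
    rw [LinearEquiv.symm_apply_eq, e1, map_smul, map_smul, hσ, hρ]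
    simp only [LinearMap.smul_apply, map_smul, H.ZX, hYX, hYZ, hXZ, map_smul, smul_eq_mul]
    match_scalars
    · linear_combination -c * hr
    · ring
    · linear_combination c * hr

end IsHyperbolicFrame

end HyperbolicFrame

/-! ### Bivectors -/

section Wedge

variable {F V : Type*} [Field F] [AddCommGroup V] [Module F V]

theorem wedge_add_left (u u' v : V) : wedge F (u + u') v = wedge F u v + wedge F u' v := by
  ext
  simp [wedge, ExteriorAlgebra.ιMulti_apply, add_mul]

theorem wedge_add_right (u v v' : V) : wedge F u (v + v') = wedge F u v + wedge F u v' := by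
  ext
  simp [wedge, ExteriorAlgebra.ιMulti_apply, mul_add]

theorem wedge_smul_left (c : F) (u v : V) : wedge F (c • u) v = c • wedge F u v := by
  ext
  simp [wedge, ExteriorAlgebra.ιMulti_apply]

theorem wedge_smul_right (c : F) (u v : V) : wedge F u (c • v) = c • wedge F u v := by
  ext
  simp [wedge, ExteriorAlgebra.ιMulti_apply]

end Wedge

/-! ### Linear algebra in `V` and consequences of `K` being non-split -/

namespace HodgeSpace

variable {F V : Type*} [Field F] [AddCommGroup V] [Module F V] (S : HodgeSpace F V)

/-- Four linearly independent vectors, as a basis. -/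
theorem exists_basis (S : HodgeSpace F V) {a b c d : V}
    (H : ∀ p q r s : F, p • a + q • b + r • c + s • d = 0 → p = 0 ∧ q = 0 ∧ r = 0 ∧ s = 0) :
    ∃ v : Basis (Fin 4) F V, v 0 = a ∧ v 1 = b ∧ v 2 = c ∧ v 3 = d := by
  have hl : LinearIndependent F ![a, b, c, d] := by
    rw [Fintype.linearIndependent_iff]
    intro f hf
    simp only [Fin.sum_univ_four, Matrix.cons_val] at hf
    obtain ⟨h0, h1, h2, h3⟩ := H _ _ _ _ hf
    intro i
    fin_cases i <;> assumption
  refine ⟨basisOfLinearIndependentOfCardEqFinrank hl (by simp [S.finrank_eq]), ?_⟩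
  simp

/-- Three linear forms on `V` have a common zero. -/
theorem exists_common_zero (S : HodgeSpace F V) (φ ψ χ : V →ₗ[F] F) :
    ∃ u : V, u ≠ 0 ∧ φ u = 0 ∧ ψ u = 0 ∧ χ u = 0 := by
  have := S.finite
  have h := LinearMap.ker_ne_bot_of_finrank_lt (f := φ.prod (ψ.prod χ))
    (by rw [S.finrank_eq]; simp)
  obtain ⟨u, hu, h0⟩ := Submodule.exists_mem_ne_zero_of_ne_bot h
  simp at hu
  exact ⟨u, h0, hu⟩

theorem exists_apply_eq_one {z : V} (hz : z ≠ 0) : ∃ y, S.h z y = 1 := by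
  by_contra! hne
  refine hz (S.nondeg.1 z fun y => ?_)
  by_contra h0
  exact hne ((S.h z y)⁻¹ • y) (by simp [h0])

/-- If `δ = d²`, then `(d + j)(-d + j) = δ - d² = 0`. -/
theorem isSplitAlg_of_sq {d : F} (hd : d ^ 2 = S.delta) : IsSplitAlg S.K := by
  refine ⟨⟨d, 1⟩, ⟨-d, 1⟩, ?_, ?_, ?_⟩
  · intro h
    simpa using congrArg QuadraticAlgebra.im h
  · intro h
    simpa using congrArg QuadraticAlgebra.im h
  · ext
    · simp [← hd]
      ring
    · simp

theorem exists_inv_of_not_isSplitAlg (hK : ¬ IsSplitAlg S.K) (c : S.K) (hc : c ≠ 0) :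
    ∃ d, c * d = 1 := by
  have : Fact (∀ r : F, r ^ 2 ≠ S.delta + 0 * r) :=
    ⟨fun r hr => hK (S.isSplitAlg_of_sq (d := r) (by simpa using hr))⟩
  exact ⟨c⁻¹, mul_inv_cancel₀ hc⟩

/-- If the algebra `K` is not split, then there are no totally isotropic planes. -/
theorem not_isotropic_of_orthogonal (hK : ¬ IsSplitAlg S.K) {z w : V} (hz : z ≠ 0)
    (hzz : S.h z z = 0) (hzw : S.h z w = 0) (hw : ∀ c : F, w ≠ c • z) : S.h w w ≠ 0 := by
  intro hww
  obtain ⟨y, hy⟩ := S.exists_apply_eq_one hz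
  -- Within the supposed totally isotropic plane, `w` is replaced by a vector orthogonal to `y`;
  -- then `u` is a dual partner of `x` orthogonal to `z`.
  obtain ⟨x, hxdef⟩ : ∃ x, x = w - S.h w y • z := ⟨_, rfl⟩
  have hwz : S.h w z = 0 := by rw [S.symm.eq, hzw]
  have hx0 : x ≠ 0 := by
    intro h0
    exact hw _ (sub_eq_zero.1 (hxdef.symm.trans h0))
  have hzx : S.h z x = 0 := by simp [hxdef, hzz, hzw]
  have hxx : S.h x x = 0 := by simp [hxdef, hzz, hzw, hwz, hww]
  have hxy : S.h x y = 0 := by simp [hxdef, hy]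
  obtain ⟨u₀, hu₀⟩ := S.exists_apply_eq_one hx0
  obtain ⟨u, hudef⟩ : ∃ u, u = u₀ - S.h z u₀ • y := ⟨_, rfl⟩
  have hzu : S.h z u = 0 := by simp [hudef, hy]
  have hxu : S.h x u = 1 := by simp [hudef, hxy, hu₀]
  have hxz : S.h x z = 0 := by rw [S.symm.eq, hzx]
  have hyz : S.h y z = 1 := by rw [S.symm.eq, hy]
  have hyx : S.h y x = 0 := by rw [S.symm.eq, hxy]
  have huz : S.h u z = 0 := by rw [S.symm.eq, hzu]
  have hux : S.h u x = 1 := by rw [S.symm.eq, hxu]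
  obtain ⟨v, h0, h1, h2, h3⟩ := S.exists_basis (a := z) (b := x) (c := y) (d := u) (by
    intro p q r s h
    have hr : r = 0 := by simpa [hzz, hzx, hy, hzu] using congrArg (S.h z) h
    have hs : s = 0 := by simpa [hxz, hxx, hxy, hxu] using congrArg (S.h x) h
    subst hr hs
    refine ⟨by simpa [hyz, hyx] using congrArg (S.h y) h,
      by simpa [huz, hux] using congrArg (S.h u) h, rfl, rfl⟩)
  refine hK (S.isSplitAlg_of_sq (d := (S.vol v)⁻¹) ?_)
  rw [S.delta_eq v]
  -- The Gram matrix for `z, x, y, u` has blocks `0, 1; 1, *`, so its determinant is `1` whatever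
  -- `h` does on `y, u`. Hence `δ` is the square of the inverse volume.
  have hdet : (Matrix.of fun i j => S.h (v i) (v j)).det = 1 := by
    simp only [Matrix.det_succ_row_zero, Fin.sum_univ_succ]
    simp [Fin.succAbove, h0, h1, h2, h3, hzz, hzx, hy, hzu, hxz, hxx, hxy, hxu, hyz, hyx, huz, hux]
  rw [hdet]
  simp

/-! ### Frames of `V` -/

/-- A basis of `V` consisting of a hyperbolic pair `z, y` and two vectors `w, u` orthogonal to it
and to each other, with `w` not isotropic. -/
structure IsWittFrame (z w y u : V) : Prop where
  zz : S.h z z = 0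
  zw : S.h z w = 0
  zy : S.h z y = 1
  yy : S.h y y = 0
  wy : S.h w y = 0
  ww : S.h w w ≠ 0
  zu : S.h z u = 0
  wu : S.h w u = 0
  yu : S.h y u = 0
  u_ne : u ≠ 0

variable {S}

/-- Allows `w` to be changed while the hyperbolic pair `z, y` is kept. A multiple of `z` orthogonal
to `y` vanishes, so `w` is not in `F z` and cannot be isotropic. -/
theorem exists_isWittFrame_of_hyperbolic (hK : ¬ IsSplitAlg S.K) {z w y : V} (hzz : S.h z z = 0)
    (hzw : S.h z w = 0) (hzy : S.h z y = 1) (hyy : S.h y y = 0) (hwy : S.h w y = 0) (hw : w ≠ 0) :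
    ∃ u, S.IsWittFrame z w y u := by
  obtain ⟨u, hu, h1, h2, h3⟩ := S.exists_common_zero (S.h z) (S.h w) (S.h y)
  refine ⟨u, hzz, hzw, hzy, hyy, hwy, ?_, h1, h2, h3, hu⟩
  refine S.not_isotropic_of_orthogonal hK ?_ hzz hzw ?_
  · rintro rfl
    simp at hzy
  · rintro c rfl
    have hc : c = 0 := by simpa [hzy] using hwy
    exact hw (by simp [hc])

/-- Gram–Schmidt: a vector `y₀` with `h(z, y₀) = 1` is made orthogonal to the anisotropic `w`, and
then isotropic by subtracting a multiple of `z`, which needs division by `2`. -/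
theorem exists_isWittFrame (hF : (2 : F) ≠ 0) (hK : ¬ IsSplitAlg S.K) {z w : V} (hz : z ≠ 0)
    (hzz : S.h z z = 0) (hzw : S.h z w = 0) (hw : ∀ c : F, w ≠ c • z) :
    ∃ y u, S.IsWittFrame z w y u := by
  have hww := S.not_isotropic_of_orthogonal hK hz hzz hzw hw
  have hwz : S.h w z = 0 := by rw [S.symm.eq, hzw]
  obtain ⟨y₀, hy₀⟩ := S.exists_apply_eq_one hz
  obtain ⟨y₁, hdef⟩ : ∃ y, y = y₀ - (S.h w y₀ / S.h w w) • w := ⟨_, rfl⟩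
  have h1 : S.h z y₁ = 1 := by simp [hdef, hy₀, hzw]
  have h2 : S.h w y₁ = 0 := by simp [hdef, hww]
  have h3 : S.h y₁ z = 1 := by rw [S.symm.eq, h1]
  refine ⟨y₁ - (S.h y₁ y₁ / 2) • z, exists_isWittFrame_of_hyperbolic hK hzz hzw ?_ ?_ ?_ ?_⟩
  · simp [h1, hzz]
  · simp [h1, h3, hzz]
    field_simp
    ring
  · simp [h2, hwz]
  · simpa using hw 0

namespace IsWittFrame

variable {z w y u : V}

theorem wz (H : S.IsWittFrame z w y u) : S.h w z = 0 := by rw [S.symm.eq, H.zw]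
theorem yz (H : S.IsWittFrame z w y u) : S.h y z = 1 := by rw [S.symm.eq, H.zy]
theorem yw (H : S.IsWittFrame z w y u) : S.h y w = 0 := by rw [S.symm.eq, H.wy]
theorem uy (H : S.IsWittFrame z w y u) : S.h u y = 0 := by rw [S.symm.eq, H.yu]

theorem exists_basis (H : S.IsWittFrame z w y u) :
    ∃ v : Basis (Fin 4) F V, v 0 = z ∧ v 1 = w ∧ v 2 = y ∧ v 3 = u := by
  refine S.exists_basis fun p q r s h => ?_
  have hr : r = 0 := by simpa [H.zz, H.zw, H.zy, H.zu] using congrArg (S.h z) h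
  have hq : q = 0 := by simpa [H.wz, H.ww, H.wy, H.wu] using congrArg (S.h w) h
  have hp : p = 0 := by simpa [H.yz, H.yw, H.yy, H.yu] using congrArg (S.h y) h
  subst hr hq hp
  exact ⟨rfl, rfl, rfl, by simpa [H.u_ne] using h⟩

/-- Among the six basis bivectors only `w ∧ y` pairs non-trivially with `z ∧ w` under `⋀²h`, and its
complement with respect to `Pf` is `z ∧ u`. Thus the `K`-line of `z ∧ w` consists of bivectors
divisible by `z`. -/
theorem hodge_wedge (H : S.IsWittFrame z w y u) :
    ∃ c : F, S.hodge (wedge F z w) = wedge F z (c • u) := by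
  obtain ⟨v, h0, h1, h2, h3⟩ := H.exists_basis
  refine ⟨(S.vol v)⁻¹ * -S.h w w, ?_⟩
  rw [S.hodge_eq_pfInv v, pfInv, wedge_smul_right]
  simp [h0, h1, h2, h3, extForm_wedge, H.zz, H.zw, H.zy, H.zu, H.wz, H.wy, H.wu, smul_smul]
  exact (neg_smul _ _).symm

/-- The `K`-multiples of `z ∧ w`. -/
theorem smul_wedge (H : S.IsWittFrame z w y u) (k : S.K) :
    ∃ w', S.h z w' = 0 ∧ S.h w' y = 0 ∧ k • S.toW (wedge F z w) = S.toW (wedge F z w') := by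
  obtain ⟨c, hc⟩ := H.hodge_wedge
  refine ⟨k.re • w + k.im • c • u, by simp [H.zw, H.zu], by simp [H.wy, H.uy], ?_⟩
  rw [smul_def, LinearEquiv.symm_apply_apply, hc, wedge_add_right, wedge_smul_right k.re,
    wedge_smul_right k.im]

/-- The form `g` is non-degenerate on the bivectors of a frame. -/
theorem eq_zero_of_g_eq_zero (H : S.IsWittFrame z w y u) {A : S.W}
    (h1 : S.g (S.toW (wedge F z w)) A = 0) (h2 : S.g (S.toW (wedge F z y)) A = 0)
    (h3 : S.g (S.toW (wedge F w y)) A = 0) : A = 0 := by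
  obtain ⟨v, hv0, hv1, hv2, hv3⟩ := H.exists_basis
  obtain ⟨x, rfl⟩ := S.toW.surjective A
  have key : ∀ B, S.g (S.toW B) (S.toW x) = 0 → extForm S.h B x = 0 ∧ S.pf x B = 0 := by
    intro B hB
    rw [S.pf_symm]
    simpa [g_apply, QuadraticAlgebra.ext_iff] using hB
  obtain ⟨e1, p1⟩ := key _ h1
  obtain ⟨e2, p2⟩ := key _ h2
  obtain ⟨e3, p3⟩ := key _ h3
  -- The `Pf`-parts of the three conditions remove all bivectors involving `u`. What remains lives
  -- on the span of `z, w, y`, where the `⋀²h`-parts determine the coefficients.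
  obtain ⟨α, β, γ, hx⟩ : ∃ α β γ : F,
      x = α • wedge F z w + β • wedge F z y + γ • wedge F w y := by
    have hx : S.pfInv v (S.pf x) = x := S.pf_bijective.1 (S.pf_pfInv v _)
    refine ⟨(S.vol v)⁻¹ * S.pf x (wedge F y u), -(S.vol v)⁻¹ * S.pf x (wedge F w u),
      (S.vol v)⁻¹ * S.pf x (wedge F z u), ?_⟩
    conv_lhs => rw [← hx]
    simp only [pfInv, hv0, hv1, hv2, hv3, p1, p2, p3]
    module
  rw [hx] at e1 e2 e3 ⊢
  simp [extForm_wedge, H.zz, H.zw, H.zy, H.wz, H.wy, H.yy, H.yz, H.yw, H.ww] at e1 e2 e3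
  simp [e1, e2, e3]

/-- Any two of these bivectors share a factor up to scalars, so `Pf` vanishes between them and `g`
takes values in `F`, given by 2×2 Gram determinants. The scalar `-h(w, w)⁻¹` normalizes `g(Z, X)` to
`1`. The expansion holds since the difference of its two sides is orthogonal to the frame. -/
theorem isHyperbolicFrame (H : S.IsWittFrame z w y u) :
    IsHyperbolicFrame S.g (S.toW (wedge F z w)) (S.toW (wedge F z y))
      (S.toW (wedge F (-(S.h w w)⁻¹ • w) y)) := by
  have hww := H.ww
  have hg : ∀ a b c d : V, S.g (S.toW (wedge F a b)) (S.toW (wedge F c d)) =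
      ⟨S.h a c * S.h b d - S.h a d * S.h b c, S.pf (wedge F a b) (wedge F c d)⟩ := by
    intro a b c d
    simp [g_apply, extForm_wedge]
  have p1 : ∀ a b c : V, S.pf (wedge F a b) (wedge F a c) = 0 := fun a b c => by
    rw [pf_wedge, AlternatingMap.map_eq_zero_of_eq _ _ (i := 0) (j := 2) rfl (by decide), map_zero]
  have p2 : ∀ a b c : V, S.pf (wedge F a b) (wedge F b c) = 0 := fun a b c => by
    rw [pf_wedge, AlternatingMap.map_eq_zero_of_eq _ _ (i := 1) (j := 2) rfl (by decide), map_zero]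
  have p3 : ∀ a b c : V, S.pf (wedge F a b) (wedge F c b) = 0 := fun a b c => by
    rw [pf_wedge, AlternatingMap.map_eq_zero_of_eq _ _ (i := 1) (j := 3) rfl (by decide), map_zero]
  have ZZ : S.g (S.toW (wedge F z w)) (S.toW (wedge F z w)) = 0 := by
    rw [hg]; ext <;> simp [p1, H.zz, H.zw]
  have ZY : S.g (S.toW (wedge F z w)) (S.toW (wedge F z y)) = 0 := by
    rw [hg]; ext <;> simp [p1, H.zz, H.wz]
  have ZX : S.g (S.toW (wedge F z w)) (S.toW (wedge F (-(S.h w w)⁻¹ • w) y)) = 1 := by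
    rw [hg, wedge_smul_left]; ext <;> simp [p2, H.zw, H.zy, hww] <;> rfl
  have YY : S.g (S.toW (wedge F z y)) (S.toW (wedge F z y)) = -1 := by
    rw [hg]; ext <;> simp [p1, H.zz, H.zy, H.yz] <;> rfl
  have XY : S.g (S.toW (wedge F (-(S.h w w)⁻¹ • w) y)) (S.toW (wedge F z y)) = 0 := by
    rw [hg]; ext <;> simp [p3, H.wz, H.wy]
  have XX : S.g (S.toW (wedge F (-(S.h w w)⁻¹ • w) y))
      (S.toW (wedge F (-(S.h w w)⁻¹ • w) y)) = 0 := by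
    rw [hg]; ext <;> simp [p1, H.wy, H.yy]
  refine ⟨ZZ, ZY, ZX, YY, XY, XX, fun A => ?_⟩
  have YZ := (S.g_symm.eq _ _).trans ZY
  have XZ := (S.g_symm.eq _ _).trans ZX
  have YX := (S.g_symm.eq _ _).trans XY
  have hX : S.toW (wedge F w y) =
      (⟨-S.h w w, 0⟩ : S.K) • S.toW (wedge F (-(S.h w w)⁻¹ • w) y) := by
    rw [wedge_smul_left]
    simp [smul_def, smul_smul, hww]
  rw [← sub_eq_zero]
  apply H.eq_zero_of_g_eq_zero
  · simp only [map_sub, map_add, map_smul, ZZ, ZY, ZX, smul_eq_mul]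
    ring
  · simp only [map_sub, map_add, map_smul, YZ, YY, YX, smul_eq_mul]
    ring
  · rw [hX]
    simp only [map_sub, map_add, map_smul, LinearMap.smul_apply, XZ, XY, XX, smul_eq_mul]
    ring

/-- In the basis `z, w, y, u` the map is upper unitriangular. -/
theorem det_eichler (H : S.IsWittFrame z w y u) {p : F} (hp : p + p = S.h w w) {f : V →ₗ[F] V}
    (hf : ∀ x, f x = x + S.h w x • z - S.h z x • (w + p • z)) : LinearMap.det f = 1 := by
  obtain ⟨v, h0, h1, h2, h3⟩ := H.exists_basis
  have hm : LinearMap.toMatrix v v f = !![1, p + p, -p, 0; 0, 1, -1, 0; 0, 0, 1, 0; 0, 0, 0, 1] := by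
    have e0 : f (v 0) = v 0 := by simp [hf, h0, H.wz, H.zz]
    have e1 : f (v 1) = v 1 + (p + p) • v 0 := by simp [hf, h0, h1, H.zw, hp]
    have e2 : f (v 2) = v 2 - v 1 - p • v 0 := by
      simp [hf, h0, h1, h2, H.wy, H.zy]
      abel
    have e3 : f (v 3) = v 3 := by simp [hf, h3, H.wu, H.zu]
    ext i j
    rw [LinearMap.toMatrix_apply]
    fin_cases j <;> fin_cases i <;> simp [e0, e1, e2, e3]
  rw [← LinearMap.det_toMatrix v, hm]
  simp [Matrix.det_succ_row_zero, Fin.sum_univ_succ, Fin.succAbove]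

/-- The homomorphism `η` maps `Σ_{z,w,p}` to `Σ_{z∧w,z∧y,-1/2}`. -/
theorem eta_eichler (hF : (2 : F) ≠ 0) (H : S.IsWittFrame z w y u) {p : F}
    (hp : p + p = S.h w w) {s : specialOrthGroup S.h}
    (hs : ∀ x, s.1.1 x = x + S.h w x • z - S.h z x • (w + p • z)) (A : S.W) :
    (S.eta s).1 A = A + S.g (S.toW (wedge F z y)) A • S.toW (wedge F z w) -
      S.g (S.toW (wedge F z w)) A •
        (S.toW (wedge F z y) + (-⟨2⁻¹, 0⟩ : S.K) • S.toW (wedge F z w)) := by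
  have G := H.isHyperbolicFrame
  have hYZ := (S.g_symm.eq _ _).trans G.ZY
  have hYX := (S.g_symm.eq _ _).trans G.XY
  have hr : (-⟨2⁻¹, 0⟩ : S.K) • S.toW (wedge F z w) = -(2⁻¹ : F) • S.toW (wedge F z w) := by
    simp [smul_def]
  have sz : s.1.1 z = z := by simp [hs, H.zz, H.wz]
  have sw : s.1.1 w = w + S.h w w • z := by simp [hs, H.zw]
  have sy : s.1.1 y = y + (-1 : F) • w + (-p) • z := by
    simp only [hs, H.wy, H.zy]
    module
  let f : S.W →ₗ[S.K] S.W := LinearMap.id +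
    (S.g (S.toW (wedge F z y))).smulRight (S.toW (wedge F z w)) -
    (S.g (S.toW (wedge F z w))).smulRight
      (S.toW (wedge F z y) + (-⟨2⁻¹, 0⟩ : S.K) • S.toW (wedge F z w))
  have hf : ∀ A, f A = A + S.g (S.toW (wedge F z y)) A • S.toW (wedge F z w) -
      S.g (S.toW (wedge F z w)) A •
        (S.toW (wedge F z y) + (-⟨2⁻¹, 0⟩ : S.K) • S.toW (wedge F z w)) := fun _ => rfl
  -- Both sides are `K`-linear, so it suffices to compare them on the hyperbolic frame.
  suffices h : ((S.eta s).1 : S.W →ₗ[S.K] S.W) = f from congrArg (fun f => f A) h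
  refine G.hom_ext ?_ ?_ ?_
  · rw [hf, G.ZZ, hYZ, LinearEquiv.coe_coe, eta_wedge, sz, sw, wedge_add_right, wedge_smul_right,
      wedge_self]
    simp
  · rw [hf, G.ZY, G.YY, LinearEquiv.coe_coe, eta_wedge, sz, sy, wedge_add_right, wedge_add_right,
      wedge_smul_right, wedge_smul_right, wedge_self]
    simp
  · rw [hf, G.ZX, hYX, hr, LinearEquiv.coe_coe, eta_wedge, map_smul, sy, sw]
    simp only [wedge_add_left, wedge_add_right, wedge_smul_left, wedge_smul_right, wedge_self,
      wedge_swap w z, map_add, map_smul, map_neg, map_zero, one_smul, zero_smul]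
    have hww := H.ww
    match_scalars
    · ring
    · field_simp
    · field_simp
      linear_combination -hp

end IsWittFrame

/-! ### Isotropic bivectors -/

/-- A bivector `x` with `x ∧ x = 0` is decomposable. -/
theorem exists_eq_wedge (hF : (2 : F) ≠ 0) {x : ⋀[F]^2 V} (hx : S.pf x x = 0) :
    ∃ a b : V, x = wedge F a b := by
  by_cases h0 : x = 0
  · exact ⟨0, 0, by rw [h0, wedge_self]⟩
  -- Some Plücker coordinate of `x` is non-zero, as `Pf` is non-degenerate; permuting the basis
  -- moves it to the indices `0, 1`.
  obtain ⟨v, hv⟩ : ∃ v : Basis (Fin 4) F V, S.pf x (wedge F (v 0) (v 1)) ≠ 0 := by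
    by_contra! hne
    refine h0 (S.pf_bijective.1 ?_)
    rw [map_zero]
    refine exteriorPower.linearMap_ext (Basis.ext_alternating S.basis fun i hi => ?_)
    have hσ : ∀ i j : Fin 4, i ≠ j → ∃ σ : Equiv.Perm (Fin 4), σ 0 = i ∧ σ 1 = j := by decide
    obtain ⟨σ, hσ0, hσ1⟩ := hσ (i 0) (i 1) (hi.ne (by decide))
    simpa [ιMulti_two, hσ0, hσ1] using hne (S.basis.reindex σ.symm)
  have hvol := S.vol_ne_zero v
  have e : S.pfInv v (S.pf x) = x := S.pf_bijective.1 (S.pf_pfInv v _)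
  -- The Plücker relation: up to the volume factor, `Pf(x, x)` is twice the left-hand side.
  have hq : S.pf x (wedge F (v 0) (v 1)) * S.pf x (wedge F (v 2) (v 3)) -
      S.pf x (wedge F (v 0) (v 2)) * S.pf x (wedge F (v 1) (v 3)) +
      S.pf x (wedge F (v 0) (v 3)) * S.pf x (wedge F (v 1) (v 2)) = 0 := by
    have h : S.pf x (S.pfInv v (S.pf x)) = 0 := by rw [e, hx]
    simp only [pfInv, map_smul, map_add, map_sub, smul_eq_mul] at h
    have h' := (mul_eq_zero.1 h).resolve_left (inv_ne_zero hvol)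
    have h2 : (2 : F) * (S.pf x (wedge F (v 0) (v 1)) * S.pf x (wedge F (v 2) (v 3)) -
      S.pf x (wedge F (v 0) (v 2)) * S.pf x (wedge F (v 1) (v 3)) +
      S.pf x (wedge F (v 0) (v 3)) * S.pf x (wedge F (v 1) (v 2))) = 0 := by
      linear_combination h'
    exact (mul_eq_zero.1 h2).resolve_left hF
  rw [pfInv] at e
  generalize S.pf x (wedge F (v 0) (v 1)) = p01 at *
  generalize S.pf x (wedge F (v 0) (v 2)) = p02 at *
  generalize S.pf x (wedge F (v 0) (v 3)) = p03 at *
  generalize S.pf x (wedge F (v 1) (v 2)) = p12 at *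
  generalize S.pf x (wedge F (v 1) (v 3)) = p13 at *
  generalize S.pf x (wedge F (v 2) (v 3)) = p23 at *
  -- Up to scalars, these vectors are the contractions of `x` with the coordinate forms dual to `v
  -- 3` and `v 2`.
  refine ⟨((S.vol v)⁻¹ * p01⁻¹) • (p12 • v 0 + (-p02) • v 1 + p01 • v 2),
    p13 • v 0 + (-p03) • v 1 + p01 • v 3, ?_⟩
  have hp23 : p23 = (p02 * p13 - p03 * p12) * p01⁻¹ := by
    field_simp
    linear_combination hq
  rw [← e]
  simp only [wedge_add_left, wedge_add_right, wedge_smul_left, wedge_smul_right, wedge_self,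
    wedge_swap (v 1) (v 0), wedge_swap (v 2) (v 0), wedge_swap (v 2) (v 1), hp23]
  match_scalars <;> field_simp
  ring

/-- A non-zero isotropic vector of `(⋀²V, g)` is a bivector `z ∧ w` with `z` isotropic and
orthogonal to `w`. -/
theorem exists_isWittFrame_of_g_self (hF : (2 : F) ≠ 0) (hK : ¬ IsSplitAlg S.K) {A : S.W}
    (hA : A ≠ 0) (hAA : S.g A A = 0) :
    ∃ z w y u, S.IsWittFrame z w y u ∧ A = S.toW (wedge F z w) := by
  obtain ⟨x, rfl⟩ := S.toW.surjective A
  obtain ⟨he, hp⟩ : extForm S.h x x = 0 ∧ S.pf x x = 0 := by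
    simpa [g_apply, QuadraticAlgebra.ext_iff] using hAA
  obtain ⟨a, b, rfl⟩ := exists_eq_wedge hF hp
  have h0 : wedge F a b ≠ 0 := fun h => hA (by rw [h, map_zero])
  rw [extForm_wedge, S.symm.eq b a] at he
  -- The Gram determinant of `a, b` is zero, so the plane has a non-zero radical: it contains `a` if
  -- `a` is isotropic, and otherwise the component of `b` orthogonal to `a`.
  obtain ⟨z, w, hzz, hzw, hw⟩ :
      ∃ z w, S.h z z = 0 ∧ S.h z w = 0 ∧ wedge F a b = wedge F z w := by
    by_cases haa : S.h a a = 0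
    · refine ⟨a, b, haa, ?_, rfl⟩
      rw [haa, zero_mul, zero_sub, neg_eq_zero, mul_self_eq_zero] at he
      exact he
    · refine ⟨b + (-(S.h a b / S.h a a)) • a, (-1 : F) • a, ?_, ?_, ?_⟩
      · simp [S.symm.eq b a]
        field_simp
        linear_combination he
      · simp [S.symm.eq b a, haa]
      · rw [wedge_add_left, wedge_smul_right, wedge_smul_left, wedge_smul_right, wedge_self,
          wedge_swap b a]
        simp
  rw [hw] at h0 ⊢
  obtain ⟨y, u, H⟩ := exists_isWittFrame hF hK (z := z) (w := w)
    (by rintro rfl; exact h0 (by simpa using wedge_smul_left (F := F) 0 0 w)) hzz hzw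
    (by rintro c rfl; exact h0 (by rw [wedge_smul_right, wedge_self, smul_zero]))
  exact ⟨z, w, y, u, H, rfl⟩

/-! ### The three assertions -/

theorem orthGroup_eq_one {R M : Type*} [CommRing R] [AddCommGroup M] [Module R M]
    {B : LinearMap.BilinForm R M} {τ : orthGroup B} (h : ∀ x, τ.1 x = x) : τ = 1 :=
  Subtype.ext (LinearEquiv.ext h)

theorem half_add_half (hF : (2 : F) ≠ 0) : (⟨2⁻¹, 0⟩ : S.K) + ⟨2⁻¹, 0⟩ = 1 := by
  have h2 : (2⁻¹ : F) + 2⁻¹ = 1 := by field_simp; norm_num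
  exact QuadraticAlgebra.ext h2 (add_zero 0)

theorem eichlerGroup_le_range_eta (hF : (2 : F) ≠ 0) (hK : ¬ IsSplitAlg S.K) :
    eichlerGroup S.g ≤ S.eta.range := by
  refine (Subgroup.closure_le _).2 ?_
  rintro τ ⟨Z, W, P, hZZ, hZW, hP, hτ⟩
  by_cases hZ : Z = 0
  · rw [orthGroup_eq_one (τ := τ) fun x => by simp [hτ, hZ]]
    exact one_mem _
  obtain ⟨z, w, y, u, H, rfl⟩ := exists_isWittFrame_of_g_self hF hK hZ hZZ
  obtain ⟨k, hk⟩ := H.isHyperbolicFrame.eichler_eq S.g_symm (half_add_half hF) hZW hP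
  obtain ⟨w', hzw', hwy', hw'⟩ := H.smul_wedge k
  simp only [hk, hw'] at hτ
  by_cases hw0 : w' = 0
  · have h0 : wedge F z w' = 0 := by
      rw [hw0]
      simpa using wedge_smul_right (F := F) 0 z 0
    rw [orthGroup_eq_one (τ := τ) fun x => by simp [hτ, h0]]
    exact one_mem _
  -- The new frame keeps `z` and `y`, so `Σ_{z,w',p}` has exactly `Σ_{z∧w',z∧y,-1/2}` as its image.
  obtain ⟨u', H'⟩ := exists_isWittFrame_of_hyperbolic hK H.zz hzw' H.zy H.yy hwy' hw0
  have hp : S.h w' w' / 2 + S.h w' w' / 2 = S.h w' w' := by field_simp; ring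
  obtain ⟨s, hs⟩ := exists_eichler S.symm H.zz hzw' hp
  refine ⟨⟨s, H'.det_eichler hp hs⟩, Subtype.ext (LinearEquiv.ext fun A => ?_)⟩
  rw [H'.eta_eichler hF hp hs, hτ]

theorem isEichler_eta (hF : (2 : F) ≠ 0) (hK : ¬ IsSplitAlg S.K) (τ : orthGroup S.h)
    (hτ : IsEichler S.h τ) :
    ∃ hτ : τ ∈ specialOrthGroup S.h, IsEichler S.g (S.eta ⟨τ, hτ⟩) := by
  obtain ⟨z, w, p, hzz, hzw, hp, hτ⟩ := hτ
  by_cases h1 : τ = 1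
  · subst h1
    refine ⟨one_mem _, 0, 0, 0, by simp, by simp, by simp, fun x => ?_⟩
    rw [show (⟨1, one_mem _⟩ : specialOrthGroup S.h) = 1 from rfl, map_one]
    simp
  have hz : z ≠ 0 := by
    rintro rfl
    exact h1 (orthGroup_eq_one fun x => by simp [hτ])
  have hw : ∀ c : F, w ≠ c • z := by
    rintro c rfl
    refine h1 (orthGroup_eq_one fun x => ?_)
    have hp0 : p = 0 := by
      have : 2 * p = 0 := by simpa [hzz, two_mul] using hp
      exact (mul_eq_zero.1 this).resolve_left hF
    simp [hτ, hp0, smul_smul, mul_comm]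
  obtain ⟨y, u, H⟩ := exists_isWittFrame hF hK hz hzz hzw hw
  have G := H.isHyperbolicFrame
  refine ⟨H.det_eichler hp hτ, _, _, _, G.ZZ, G.ZY, ?_, H.eta_eichler hF hp hτ⟩
  rw [G.YY, ← neg_add, half_add_half hF]

theorem absolutePoints_g_nonempty (hF : (2 : F) ≠ 0) (hK : ¬ IsSplitAlg S.K) {z : V} (hz : z ≠ 0)
    (hzz : S.h z z = 0) : (absolutePoints S.g).Nonempty := by
  obtain ⟨y, hy⟩ := S.exists_apply_eq_one hz
  -- Only two conditions on `w` are needed; the third form is a dummy `0`. Orthogonality to `y`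
  -- keeps `w` out of `F z`.
  obtain ⟨w, hw0, hzw, hyw, -⟩ := S.exists_common_zero (S.h z) (S.h y) 0
  obtain ⟨y', u, H⟩ := exists_isWittFrame hF hK hz hzz hzw (by
    rintro c rfl
    have hc : c = 0 := by simpa [S.symm.eq y z, hy] using hyw
    exact hw0 (by simp [hc]))
  have G := H.isHyperbolicFrame
  refine ⟨_, ⟨S.toW (wedge F z w), fun h0 => ?_, rfl⟩, fun A hA B hB => ?_⟩
  · have h := G.ZX
    rw [h0, map_zero, LinearMap.zero_apply] at h
    exact zero_ne_one (congrArg QuadraticAlgebra.re h)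
  · obtain ⟨a, rfl⟩ := Submodule.mem_span_singleton.1 hA
    obtain ⟨b, rfl⟩ := Submodule.mem_span_singleton.1 hB
    simp [G.ZZ]

/-- A hyperbolic frame is chosen with its first vector spanning the target `Q`; the Eichler group
moves `P` there, and it lies in the image of `η`. -/
theorem isPretransitive_absolutePoints_g (hF : (2 : F) ≠ 0) (hK : ¬ IsSplitAlg S.K) :
    MulAction.IsPretransitive S.eta.range (absolutePoints S.g) := by
  refine ⟨fun P Q => ?_⟩
  obtain ⟨⟨Z, hZ, hQ⟩, hQ'⟩ := Q.2
  have hZmem : Z ∈ Q.1 := by rw [hQ]; exact Submodule.mem_span_singleton_self Z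
  obtain ⟨z, w, y, u, H, rfl⟩ := exists_isWittFrame_of_g_self hF hK hZ (hQ' hZmem Z hZmem)
  obtain ⟨τ, hτ, h⟩ := H.isHyperbolicFrame.exists_smul_eq S.g_symm (half_add_half hF)
    (S.exists_inv_of_not_isSplitAlg hK) P
  exact ⟨⟨τ, eichlerGroup_le_range_eta hF hK hτ⟩, Subtype.ext (h.trans hQ.symm)⟩

end HodgeSpace

theorem mainTheorem9 {F V : Type*} [Field F] [AddCommGroup V] [Module F V]
    (hF : ringChar F ≠ 2) (S : HodgeSpace F V) (hK : ¬ IsSplitAlg S.K) :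
    eichlerGroup S.g ≤ S.eta.range ∧
    (∀ τ : orthGroup S.h, IsEichler S.h τ →
      ∃ hτ : τ ∈ specialOrthGroup S.h, IsEichler S.g (S.eta ⟨τ, hτ⟩)) ∧
    ((∃ z : V, z ≠ 0 ∧ S.h z z = 0) →
      (absolutePoints S.g).Nonempty ∧
        MulAction.IsPretransitive S.eta.range (absolutePoints S.g)) := by
  have h2 : (2 : F) ≠ 0 := Ring.two_ne_zero hF
  exact ⟨HodgeSpace.eichlerGroup_le_range_eta h2 hK, HodgeSpace.isEichler_eta h2 hK,
    fun ⟨_, hz, hzz⟩ => ⟨HodgeSpace.absolutePoints_g_nonempty h2 hK hz hzz,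
      HodgeSpace.isPretransitive_absolutePoints_g h2 hK⟩⟩
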